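/- Let $f_j(y)=\frac{p_j}{q_j}y+\frac{r_j}{q_j}$, $1\le j\le J$, be contractions of $\mathbb{R}$ with $J\ge 2$, $p_j\in\{1,-1\}$, $q_j$ a positive integer and $r_j$ rational (a monic, affine, rational-preserving iterated function system). Assume the open set condition: there is a nonempty bounded open set $O\subseteq\mathbb{R}$ with $f_j(O)\subseteq O$ for all $j$ and $f_i(O)\cap f_j(O)=\emptyset$ for $i\ne j$. Let $C$ be the attractor, that is, the nonempty compact set with $C=\bigcup_{j} f_j(C)$, and let $\Delta$ be its Hausdorff dimension. Write $d(C,x)=\inf_{c\in C}|c-x|$. Then there is $\rho_0=\rho_0(C)$ such that for every $\rho\ge\rho_0$ $$d\Big(C,\frac pq\Big)>e^{-\rho q^{\Delta}}$$ for all integers $p$ and $q\ge 1$ with $p/q\notin C$. Moreover, let $b\ge 3$ be an integer and $W\subseteq\{0,1,\dots,b-1\}$ with $2\le |W|\le b-1$, and let $C_{b,W}=\{\sum_{i\ge1}w_ib^{-i}: w_i\in W \text{ for all } i\}$ be the missing digit Cantor set. Then its Hausdorff dimension is $\Delta=\log|W|/\log b$, and $$d\Big(C_{b,W},\frac pq\Big)>\frac{b^{-(2b)^{\Delta}q^{\Delta}}}{2q}$$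 for all integers $p$ and $q\ge 1$ with $p/q\notin C_{b,W}$. In particular, for every $\xi\in C_{b,W}$ and every $\delta>(2b)^{\Delta}$, the inequality $$\Big|\xi-\frac pq\Big|\le b^{-\delta q^{\Delta}}$$ has only finitely many solutions in integers $p$ and $q\ge1$ with $p/q\notin C_{b,W}$. -/

import Mathlib

/-- `C` is the attractor of the iterated function system `f 0, …, f (J - 1)` on the real line:
the nonempty compact set that is the union of its images. -/
def IsAttractor {J : ℕ} (f : Fin J → ℝ → ℝ) (C : Set ℝ) : Prop :=
  IsCompact C ∧ C.Nonempty ∧ ⋃ j, f j '' C = C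

/-- The open set condition: there is a nonempty bounded open set that is mapped into itself by
every map of the system, with pairwise disjoint images. -/
def OpenSetCondition {J : ℕ} (f : Fin J → ℝ → ℝ) : Prop :=
  ∃ O : Set ℝ, IsOpen O ∧ O.Nonempty ∧ Bornology.IsBounded O ∧
    (∀ j, f j '' O ⊆ O) ∧ ∀ i j, i ≠ j → Disjoint (f i '' O) (f j '' O)

/-- A monic affine rational-preserving iterated function system on the real line: finitely many
contractions `y ↦ (p / q) y + r / q` with `p ∈ {1, -1}`, `q` a positive integer and `r` rational. -/
def IsMonicRationalIFS {J : ℕ} (f : Fin J → ℝ → ℝ) : Prop :=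
  (∀ j, ∃ K, ContractingWith K (f j)) ∧
  ∀ j, ∃ (p : ℤ) (q : ℕ) (r : ℚ), (p = 1 ∨ p = -1) ∧ 0 < q ∧
    ∀ y : ℝ, f j y = (p : ℝ) / (q : ℝ) * y + (r : ℝ) / (q : ℝ)

/-- The missing digit Cantor set `C_{b,W}`: all numbers `∑_{i ≥ 1} w_i / b ^ i` (in `[0, 1]`)
with digits `w_i ∈ W`, where `W ⊆ {0, …, b - 1}`. -/
def missingDigitSet (b : ℕ) (W : Finset (Fin b)) : Set ℝ :=
  Real.ofDigits '' {w : ℕ → Fin b | ∀ i, w i ∈ W}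

/-! Let `x₀ = p/q` lie outside `C` and let `ξ₀` be its nearest point in `C`. Apply repeatedly to
both the inverse of a branch whose image of `C` contains the current `ξ`. Monic branches have
inverses `y ↦ ±(q_j y - r_j)`, so all `x n` stay in `(1/Q)ℤ` for a fixed `Q`, a constant multiple of
`q`. The distance to `C` at least doubles, so the `x n` are distinct, while `|x n - ξ n|` grows at
most by a factor `B` per step. As long as these differences are small compared with `1/Q`, the
points `ξ n` of `C` inherit the `1/Q` separation of the `x n`. But `C` holds only `O(Q^Δ)` such
points (`exists_card_separated_le`), so after `O(Q^Δ)` steps the difference is of order `1/Q`; hence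
`B ^ O(Q^Δ) * d(C, x₀)` is at least of that order (`inv_pow_div_lt_infDist`). The count is a
dimension estimate: `N` separated points give `N` separated small copies of `C` in itself, hence a
Cantor subset of dimension comparable to `log N / log (1/r)`. For missing digit sets, a pigeonhole
over the `b`-adic pieces replaces this count and yields the explicit constants. -/

theorem dimH_real_ne_top (C : Set ℝ) : dimH C ≠ ⊤ := by
  have h : dimH C ≤ 1 := by
    have := dimH_mono (Set.subset_univ C)
    rwa [Real.dimH_univ] at this
  exact ne_top_of_le_ne_top ENNReal.one_ne_top h

/-! ### Dimension bounds from separated copies -/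

/-- A coding of a subset of the line by sequences of `N` symbols that separates sequences first
differing at place `n` by `δ * ρ ^ n` forces the Hausdorff dimension to be at least
`log N / log (1 / ρ)`: the base `N` digit map is then Hölder and onto the unit interval. -/
theorem le_dimH_range_of_separated_coding {N : ℕ} (hN : 2 ≤ N) {π : (ℕ → Fin N) → ℝ} {δ ρ s : ℝ}
    (hδ : 0 < δ) (hρ : 0 < ρ) (hs : 0 < s) (hNs : (N : ℝ)⁻¹ = ρ ^ s)
    (hπ : ∀ v w n, (∀ i < n, v i = w i) → v n ≠ w n → δ * ρ ^ n ≤ |π v - π w|) :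
    ENNReal.ofReal s ≤ dimH (Set.range π) := by
  have key : ∀ v w : ℕ → Fin N, v ≠ w → ∃ n, (∀ i < n, v i = w i) ∧ v n ≠ w n := by
    intro v w h
    have hex : ∃ n, v n ≠ w n := Function.ne_iff.mp h
    classical
    exact ⟨Nat.find hex, fun i hi => not_not.mp (Nat.find_min hex hi), Nat.find_spec hex⟩
  have hinj : Function.Injective π := by
    intro v w h
    by_contra hne
    obtain ⟨n, h1, h2⟩ := key v w hne
    have h3 := hπ v w n h1 h2
    rw [h, sub_self, abs_zero] at h3
    have : 0 < δ * ρ ^ n := by positivity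
    linarith
  have hbound : ∀ v w, |Real.ofDigits v - Real.ofDigits w| ≤ (δ⁻¹) ^ s * |π v - π w| ^ s := by
    intro v w
    by_cases h : v = w
    · subst h
      simp only [sub_self, abs_zero]
      positivity
    obtain ⟨n, h1, h2⟩ := key v w h
    calc |Real.ofDigits v - Real.ofDigits w| ≤ ((N : ℝ) ^ n)⁻¹ :=
          Real.abs_ofDigits_sub_ofDigits_le h1
      _ = (ρ ^ n) ^ s := by
          rw [← inv_pow, hNs, ← Real.rpow_natCast, ← Real.rpow_natCast, ← Real.rpow_mul hρ.le,
            ← Real.rpow_mul hρ.le, mul_comm]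
      _ ≤ (δ⁻¹ * |π v - π w|) ^ s := by
          apply Real.rpow_le_rpow (by positivity) _ hs.le
          rw [inv_mul_eq_div, le_div_iff₀ hδ, mul_comm]
          exact hπ v w n h1 h2
      _ = _ := Real.mul_rpow (by positivity) (abs_nonneg _)
  have : Nonempty (ℕ → Fin N) := ⟨fun _ => ⟨0, by omega⟩⟩
  have hH : HolderOnWith (Real.toNNReal ((δ⁻¹) ^ s)) (Real.toNNReal s)
      (fun x => Real.ofDigits (Function.invFun π x)) (Set.range π) := by
    rintro _ ⟨v, rfl⟩ _ ⟨w, rfl⟩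
    simp only [Function.leftInverse_invFun hinj _]
    rw [edist_dist, edist_dist, Real.dist_eq, Real.dist_eq,
      ENNReal.ofReal_rpow_of_nonneg (abs_nonneg _) (NNReal.coe_nonneg _), Real.coe_toNNReal _ hs.le]
    change _ ≤ ENNReal.ofReal _ * _
    rw [← ENNReal.ofReal_mul (by positivity)]
    exact ENNReal.ofReal_le_ofReal (hbound v w)
  have himg : Set.Icc (0 : ℝ) 1 ⊆ (fun x => Real.ofDigits (Function.invFun π x)) '' Set.range π := by
    intro y hy
    obtain ⟨v, -, hv⟩ := Real.ofDigits_SurjOn (b := N) (by omega) hy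
    exact ⟨π v, ⟨v, rfl⟩, by simp only [Function.leftInverse_invFun hinj _, hv]⟩
  have h1 : dimH (Set.Icc (0 : ℝ) 1) = 1 := by
    have hne : (interior (Set.Icc (0 : ℝ) 1)).Nonempty := by
      rw [interior_Icc]
      exact Set.nonempty_Ioo.mpr zero_lt_one
    simpa using Real.dimH_of_nonempty_interior hne
  have h2 := (dimH_mono himg).trans (hH.dimH_image_le (Real.toNNReal_pos.mpr hs))
  rw [h1] at h2
  have h3 : ENNReal.ofReal s ≠ 0 := by simpa using hs
  have h4 := (ENNReal.le_div_iff_mul_le (Or.inl h3) (Or.inl ENNReal.ofReal_ne_top)).mp h2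
  rwa [one_mul] at h4

/-- The composition `g (v 0) ∘ ⋯ ∘ g (v (n - 1))`. -/
def wordMap {ι : Type*} (g : ι → ℝ → ℝ) (v : ℕ → ι) : ℕ → ℝ → ℝ
  | 0 => id
  | n + 1 => wordMap g v n ∘ g (v n)

theorem wordMap_congr {ι : Type*} (g : ι → ℝ → ℝ) {v w : ℕ → ι} {n : ℕ}
    (h : ∀ i < n, v i = w i) : wordMap g v n = wordMap g w n := by
  induction n with
  | zero => rfl
  | succ n ih =>
    simp only [wordMap]
    rw [ih fun i hi => h i (by omega), h n (by omega)]

theorem continuous_wordMap {ι : Type*} {g : ι → ℝ → ℝ} (hg : ∀ i, Continuous (g i)) (v : ℕ → ι)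
    (n : ℕ) : Continuous (wordMap g v n) := by
  induction n with
  | zero => exact continuous_id
  | succ n ih => exact ih.comp (hg _)

theorem pow_mul_le_wordMap {ι : Type*} {g : ι → ℝ → ℝ} {ρ : ℝ} (hρ : 0 ≤ ρ)
    (hg : ∀ i x y, ρ * |x - y| ≤ |g i x - g i y|) (v : ℕ → ι) (n : ℕ) (x y : ℝ) :
    ρ ^ n * |x - y| ≤ |wordMap g v n x - wordMap g v n y| := by
  induction n generalizing x y with
  | zero => simp [wordMap]
  | succ n ih =>
    calc ρ ^ (n + 1) * |x - y| = ρ ^ n * (ρ * |x - y|) := by ring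
      _ ≤ ρ ^ n * |g (v n) x - g (v n) y| := by gcongr; exact hg _ _ _
      _ ≤ _ := ih _ _

/-- If a compact set contains `N ≥ 2` separated images of itself, each under a map contracting by
at most `ρ`, then `N ≤ ρ ^ (-dimH C)`. -/
theorem card_le_rpow_dimH_of_separated {N : ℕ} (hN : 2 ≤ N) {C : Set ℝ} (hC : IsCompact C)
    (hC0 : C.Nonempty) {g : Fin N → ℝ → ℝ} (hcont : ∀ i, Continuous (g i))
    (hmaps : ∀ i, ∀ c ∈ C, g i c ∈ C) {ρ δ : ℝ} (hρ : 0 < ρ) (hρ1 : ρ < 1) (hδ : 0 < δ)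
    (hg : ∀ i x y, ρ * |x - y| ≤ |g i x - g i y|)
    (hsep : ∀ i j, i ≠ j → ∀ x ∈ C, ∀ y ∈ C, δ ≤ |g i x - g j y|) :
    (N : ℝ) ≤ (1 / ρ) ^ (dimH C).toReal := by
  -- Each `g i` maps `C` into itself, so the images along the prefixes of `v` are nested nonempty
  -- compact sets.
  have hpt : ∀ v : ℕ → Fin N, ∃ x, ∀ n, x ∈ wordMap g v n '' C := by
    intro v
    have hcpt : ∀ n, IsCompact (wordMap g v n '' C) := fun n => hC.image (continuous_wordMap hcont v n)
    obtain ⟨x, hx⟩ := IsCompact.nonempty_iInter_of_sequence_nonempty_isCompact_isClosed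
      (fun n => wordMap g v n '' C)
      (by
        rintro n _ ⟨c, hc, rfl⟩
        exact ⟨g (v n) c, hmaps _ _ hc, rfl⟩)
      (fun n => hC0.image _) (hcpt 0) (fun n => (hcpt n).isClosed)
    exact ⟨x, fun n => Set.mem_iInter.mp hx n⟩
  choose π hπ using hpt
  have hlogρ : Real.log ρ < 0 := Real.log_neg hρ hρ1
  have hN1 : (1 : ℝ) < N := by exact_mod_cast hN
  have hlogN : 0 < Real.log N := Real.log_pos hN1
  set s := Real.log N / -Real.log ρ with hs
  have hs0 : 0 < s := div_pos hlogN (by linarith)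
  have hρs : ρ ^ s = (N : ℝ)⁻¹ := by
    rw [Real.rpow_def_of_pos hρ, ← Real.exp_log (show (0 : ℝ) < (N : ℝ)⁻¹ by positivity),
      Real.log_inv, hs]
    congr 1
    rw [div_neg, mul_neg, mul_div_cancel₀ _ hlogρ.ne]
  have hle : ENNReal.ofReal s ≤ dimH C := by
    refine (le_dimH_range_of_separated_coding hN hδ hρ hs0 hρs.symm (π := π) ?_).trans (dimH_mono ?_)
    · intro v w n h1 h2
      obtain ⟨c, hc, hcv⟩ := hπ v (n + 1)
      obtain ⟨d, hd, hdw⟩ := hπ w (n + 1)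
      rw [← hcv, ← hdw]
      simp only [wordMap, Function.comp_apply]
      rw [wordMap_congr g h1]
      refine le_trans ?_ (pow_mul_le_wordMap hρ.le hg w n _ _)
      rw [mul_comm]
      gcongr
      exact hsep _ _ h2 _ hc _ hd
    · rintro _ ⟨v, rfl⟩
      obtain ⟨c, hc, h⟩ := hπ v 0
      rw [← h]
      exact hc
  have hle' : s ≤ (dimH C).toReal := (ENNReal.ofReal_le_iff_le_toReal (dimH_real_ne_top C)).mp hle
  calc (N : ℝ) = (1 / ρ) ^ s := by
        rw [one_div, Real.inv_rpow hρ.le, hρs, inv_inv]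
    _ ≤ _ := Real.rpow_le_rpow_of_exponent_le (by rw [le_div_iff₀ hρ]; linarith) hle'

/-! ### Counting separated points of a self-similar set -/

/-- Small cylinders: `C` covered by its images under similarities of ratios in `[1 / B, 1 / 2]` is
covered by images of itself under maps of any prescribed approximate ratio. -/
theorem exists_cylinder {ι : Type*} {f : ι → ℝ → ℝ} {lam : ι → ℝ} {B : ℝ} {C : Set ℝ} (hB : 1 < B)
    (hlam : ∀ j, 1 / B ≤ lam j ∧ lam j ≤ 1 / 2) (hf : ∀ j x y, |f j x - f j y| = lam j * |x - y|)
    (hmaps : ∀ j, ∀ c ∈ C, f j c ∈ C) (hcov : ∀ c ∈ C, ∃ j, ∃ c' ∈ C, f j c' = c)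
    {r : ℝ} (hr : 0 < r) (hr1 : r ≤ 1) {x : ℝ} (hx : x ∈ C) :
    ∃ (g : ℝ → ℝ) (l : ℝ), r / B < l ∧ l ≤ r ∧ (∀ y z, |g y - g z| = l * |y - z|) ∧
      (∀ c ∈ C, g c ∈ C) ∧ ∃ c ∈ C, g c = x := by
  have hB0 : 0 < B := by linarith
  -- Refine until the ratio first drops to `r` or below. The last factor is at least `1 / B` and
  -- acts on a ratio above `r`, so the ratio never falls to `r / B`.
  have aux : ∀ n : ℕ, ∃ (g : ℝ → ℝ) (l : ℝ), r / B < l ∧ (l ≤ r ∨ l ≤ (1 / 2) ^ n) ∧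
      (∀ y z, |g y - g z| = l * |y - z|) ∧ (∀ c ∈ C, g c ∈ C) ∧ ∃ c ∈ C, g c = x := by
    intro n
    induction n with
    | zero =>
      refine ⟨id, 1, ?_, Or.inr (by simp), by simp, fun c hc => hc, x, hx, rfl⟩
      rw [div_lt_one hB0]
      linarith
    | succ n ih =>
      obtain ⟨g, l, h1, h2, h3, h4, c, hc, hgc⟩ := ih
      by_cases hl : l ≤ r
      · exact ⟨g, l, h1, Or.inl hl, h3, h4, c, hc, hgc⟩
      push Not at hl
      have h2' : l ≤ (1 / 2) ^ n := h2.resolve_left hl.not_ge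
      have hl0 : 0 < l := hr.trans hl
      obtain ⟨j, c', hc', hj⟩ := hcov c hc
      refine ⟨g ∘ f j, l * lam j, ?_, Or.inr ?_, ?_, fun c hc => h4 _ (hmaps j c hc), c', hc', ?_⟩
      · calc r / B = r * (1 / B) := by ring
          _ < l * (1 / B) := by gcongr
          _ ≤ l * lam j := by gcongr; exact (hlam j).1
      · rw [pow_succ]
        exact mul_le_mul h2' (hlam j).2 (le_trans (by positivity) (hlam j).1) (by positivity)
      · intro y z
        simp only [Function.comp_apply, h3, hf]
        ring
      · simp [hj, hgc]
  obtain ⟨n, hn⟩ := exists_pow_lt_of_lt_one hr (show (1 / 2 : ℝ) < 1 by norm_num)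
  obtain ⟨g, l, h1, h2, h⟩ := aux n
  exact ⟨g, l, h1, h2.elim id fun h => h.trans hn.le, h⟩

/-- Separated subsets of a self-similar set are no larger than its Hausdorff dimension predicts. -/
theorem exists_card_separated_le {ι : Type*} {f : ι → ℝ → ℝ} {lam : ι → ℝ} {B : ℝ} {C : Set ℝ}
    (hC : IsCompact C) (hB : 1 < B)
    (hlam : ∀ j, 1 / B ≤ lam j ∧ lam j ≤ 1 / 2) (hf : ∀ j x y, |f j x - f j y| = lam j * |x - y|)
    (hmaps : ∀ j, ∀ c ∈ C, f j c ∈ C) (hcov : ∀ c ∈ C, ∃ j, ∃ c' ∈ C, f j c' = c) :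
    ∃ A : ℝ, 1 ≤ A ∧ ∀ r : ℝ, 0 < r → r ≤ 1 → ∀ S : Finset ℝ, (∀ x ∈ S, x ∈ C) →
      (∀ x ∈ S, ∀ y ∈ S, x ≠ y → r ≤ |x - y|) → (S.card : ℝ) ≤ (A / r) ^ (dimH C).toReal := by
  obtain ⟨D, hD1, hD⟩ : ∃ D : ℝ, 1 ≤ D ∧ ∀ x ∈ C, ∀ y ∈ C, |x - y| ≤ D := by
    refine ⟨max 1 (Metric.diam C), le_max_left _ _, fun x hx y hy => ?_⟩
    exact (Metric.dist_le_diam_of_mem hC.isBounded hx hy).trans (le_max_right _ _)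
  have hA : 1 ≤ 3 * D * B := by nlinarith
  -- Cylinders of ratio at most `r / (3 * D)` have diameter at most `r / 3`, so those around points
  -- `r` apart keep gaps of `r / 3`; their ratios exceed `r / (3 * D * B)`.
  refine ⟨3 * D * B, hA, fun r hr hr1 S hS hsep => ?_⟩
  have hA1 : 1 ≤ 3 * D * B / r := by
    rw [le_div_iff₀ hr]
    linarith
  by_cases hcard : S.card ≤ 1
  · calc (S.card : ℝ) ≤ 1 := by exact_mod_cast hcard
      _ ≤ _ := Real.one_le_rpow hA1 ENNReal.toReal_nonneg
  have hr3 : 0 < r / (3 * D) := by positivity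
  have hr3' : r / (3 * D) ≤ 1 := by
    rw [div_le_one (by positivity)]
    linarith
  have hcyl : ∀ i : Fin S.card, _ := fun i =>
    exists_cylinder hB hlam hf hmaps hcov hr3 hr3' (hS _ (S.equivFin.symm i).2)
  choose g l h1 h2 h3 h4 c hc hgc using hcyl
  have hB0 : 0 < B := by linarith
  have hρ : 0 < r / (3 * D) / B := by positivity
  have hne : (S : Set ℝ).Nonempty := by
    rw [Finset.coe_nonempty, ← Finset.card_pos]
    omega
  have hmain := card_le_rpow_dimH_of_separated (N := S.card) (by omega) hC (hne.mono hS)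
    (g := g) (ρ := r / (3 * D) / B) (δ := r / 3) ?_ h4 hρ ?_ (by positivity) ?_ ?_
  · convert hmain using 2
    field_simp
  · intro i
    refine (LipschitzWith.of_dist_le_mul (K := (l i).toNNReal) fun x y => ?_).continuous
    rw [Real.dist_eq, Real.dist_eq, h3, Real.coe_toNNReal _ (hρ.le.trans (h1 i).le)]
  · exact lt_of_lt_of_le (div_lt_self hr3 hB) hr3'
  · intro i x y
    rw [h3]
    gcongr
    exact (h1 i).le
  · intro i j hij x hx y hy
    have hxy : r ≤ |((S.equivFin.symm i : S) : ℝ) - (S.equivFin.symm j : S)| := by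
      refine hsep _ (S.equivFin.symm i).2 _ (S.equivFin.symm j).2 fun h => hij ?_
      exact S.equivFin.symm.injective (Subtype.ext h)
    have hsmall : ∀ i, ∀ x ∈ C, |g i x - (S.equivFin.symm i : S)| ≤ r / 3 := by
      intro i x hx
      rw [← hgc i, h3]
      calc l i * |x - c i| ≤ r / (3 * D) * D :=
            mul_le_mul (h2 i) (hD _ hx _ (hc i)) (abs_nonneg _) hr3.le
        _ = r / 3 := by field_simp
    have e1 := abs_le.mp (hsmall i x hx)
    have e2 := abs_le.mp (hsmall j y hy)
    rcases le_abs.mp hxy with h | h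
    · exact le_abs.mpr (Or.inl (by linarith))
    · exact le_abs.mpr (Or.inr (by linarith))

/-! ### Expansion by inverse branches -/

/-- Simultaneous expansion of a point `x₀` outside `C` with denominator `Q` and a point `ξ₀` of `C`,
along steps that preserve the denominator and at least double the distance to `C`. -/
theorem exists_expansion {C : Set ℝ} {Q : ℝ} {R : ℝ → ℝ → Prop}
    (step : ∀ x, (∃ k : ℤ, Q * x = k) → ∀ ξ ∈ C, ∃ x', (∃ k : ℤ, Q * x' = k) ∧ ∃ ξ' ∈ C,
      2 * Metric.infDist x C ≤ Metric.infDist x' C ∧ R (x - ξ) (x' - ξ'))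
    {x₀ ξ₀ : ℝ} (hx₀ : ∃ k : ℤ, Q * x₀ = k) (hξ₀ : ξ₀ ∈ C) (hpos : 0 < Metric.infDist x₀ C) :
    ∃ x ξ : ℕ → ℝ, x 0 = x₀ ∧ ξ 0 = ξ₀ ∧ (∀ n, ∃ k : ℤ, Q * x n = k) ∧ (∀ n, ξ n ∈ C) ∧
      Function.Injective x ∧ ∀ n, R (x n - ξ n) (x (n + 1) - ξ (n + 1)) := by
  have step' : ∀ s : {s : ℝ × ℝ // (∃ k : ℤ, Q * s.1 = k) ∧ s.2 ∈ C},
      ∃ t : {s : ℝ × ℝ // (∃ k : ℤ, Q * s.1 = k) ∧ s.2 ∈ C},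
        2 * Metric.infDist s.1.1 C ≤ Metric.infDist t.1.1 C ∧
          R (s.1.1 - s.1.2) (t.1.1 - t.1.2) := by
    rintro ⟨⟨x, ξ⟩, hx, hξ⟩
    obtain ⟨x', hx', ξ', hξ', h⟩ := step x hx ξ hξ
    exact ⟨⟨(x', ξ'), hx', hξ'⟩, h⟩
  choose T hT1 hT2 using step'
  set u : ℕ → {s : ℝ × ℝ // (∃ k : ℤ, Q * s.1 = k) ∧ s.2 ∈ C} :=
    fun n => T^[n] ⟨(x₀, ξ₀), hx₀, hξ₀⟩ with hu
  have hsucc : ∀ n, u (n + 1) = T (u n) := fun n => Function.iterate_succ_apply' T n _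
  have hdist : ∀ n, 0 < Metric.infDist (u n).1.1 C := by
    intro n
    induction n with
    | zero => exact hpos
    | succ n ih =>
      rw [hsucc]
      linarith [hT1 (u n)]
  -- Growth of the distance to `C` keeps the orbit of `x₀` from repeating.
  have hmono : StrictMono fun n => Metric.infDist (u n).1.1 C := by
    refine strictMono_nat_of_lt_succ fun n => ?_
    simp only [hsucc]
    linarith [hT1 (u n), hdist n]
  refine ⟨fun n => (u n).1.1, fun n => (u n).1.2, rfl, rfl, fun n => (u n).2.1, fun n => (u n).2.2,
    fun m n h => hmono.injective (by simp only at h ⊢; rw [h]), fun n => ?_⟩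
  simp only [hsucc]
  exact hT2 (u n)

/-- Used with `x` the preimage of a given point: undoing a branch at least doubles the distance to
`C`. -/
theorem two_mul_infDist_le {C : Set ℝ} (hC : IsCompact C) (hC0 : C.Nonempty) {g : ℝ → ℝ}
    (hmaps : ∀ c ∈ C, g c ∈ C) (hg : ∀ x y, |g x - g y| ≤ 1 / 2 * |x - y|) (x : ℝ) :
    2 * Metric.infDist (g x) C ≤ Metric.infDist x C := by
  obtain ⟨c, hc, h⟩ := hC.exists_infDist_eq_dist hC0 x
  have h1 : Metric.infDist (g x) C ≤ |g x - g c| := Metric.infDist_le_dist_of_mem (hmaps c hc)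
  rw [h, Real.dist_eq]
  linarith [hg x c]

theorem one_le_mul_abs_sub {Q x y : ℝ} (hQ : 0 < Q) (hx : ∃ k : ℤ, Q * x = k)
    (hy : ∃ k : ℤ, Q * y = k) (hxy : x ≠ y) : 1 ≤ Q * |x - y| := by
  obtain ⟨k, hk⟩ := hx
  obtain ⟨l, hl⟩ := hy
  have hkl : k - l ≠ 0 := by
    intro h
    have h' : k = l := by omega
    rw [h', ← hl] at hk
    exact hxy (mul_left_cancel₀ hQ.ne' hk)
  have h1 : (1 : ℝ) ≤ |((k - l : ℤ) : ℝ)| := by exact_mod_cast Int.one_le_abs hkl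
  have h2 : ((k - l : ℤ) : ℝ) = Q * (x - y) := by
    push_cast
    rw [← hk, ← hl]
    ring
  rwa [h2, abs_mul, abs_of_pos hQ] at h1

/-- The attractor of an affine system with the open set condition is not a point: otherwise the
maps have a common fixed point, so they commute and their images of the open set meet. -/
theorem nontrivial_of_openSetCondition {J : ℕ} (hJ : 2 ≤ J) {f : Fin J → ℝ → ℝ} {a b : Fin J → ℝ}
    (hf : ∀ j y, f j y = a j * y + b j) (hO : OpenSetCondition f) {C : Set ℝ}
    (hC0 : C.Nonempty) (hmaps : ∀ j, ∀ c ∈ C, f j c ∈ C) : C.Nontrivial := by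
  by_contra hsub
  rw [Set.not_nontrivial_iff] at hsub
  obtain ⟨c, hc⟩ := hC0
  have hfix : ∀ j, a j * c + b j = c := fun j => by
    rw [← hf]
    exact hsub (hmaps j c hc) hc
  obtain ⟨O, -, ⟨y, hy⟩, -, hOm, hOd⟩ := hO
  let i : Fin J := ⟨0, by omega⟩
  let j : Fin J := ⟨1, by omega⟩
  have hij : i ≠ j := by simp [i, j]
  have hcomm : f i (f j y) = f j (f i y) := by
    rw [hf, hf, hf, hf]
    linear_combination (a i - 1) * hfix j - (a j - 1) * hfix i
  refine Set.disjoint_left.mp (hOd i j hij) ⟨f j y, hOm j ⟨y, hy, rfl⟩, rfl⟩ ?_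
  rw [hcomm]
  exact ⟨f i y, hOm i ⟨y, hy, rfl⟩, rfl⟩

/-- Lower bound for the distance from a point with denominator `Q` to a self-similar set, when the
inverse branches of the system preserve the denominator. -/
theorem inv_pow_div_lt_infDist {C : Set ℝ} (hC : IsCompact C) (hC0 : C.Nonempty) {Q B A Δ : ℝ}
    (hQ : 1 ≤ Q) (hB : 1 ≤ B) (hA : 1 ≤ A)
    (hcard : ∀ r : ℝ, 0 < r → r ≤ 1 → ∀ S : Finset ℝ, (∀ x ∈ S, x ∈ C) →
      (∀ x ∈ S, ∀ y ∈ S, x ≠ y → r ≤ |x - y|) → (S.card : ℝ) ≤ (A / r) ^ Δ)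
    (step : ∀ x, (∃ k : ℤ, Q * x = k) → ∀ ξ ∈ C, ∃ x', (∃ k : ℤ, Q * x' = k) ∧ ∃ ξ' ∈ C,
      2 * Metric.infDist x C ≤ Metric.infDist x' C ∧ |x' - ξ'| ≤ B * |x - ξ|)
    {x₀ : ℝ} (hx₀ : ∃ k : ℤ, Q * x₀ = k) (hxC : x₀ ∉ C) :
    B ^ (-((2 * Q * A) ^ Δ)) / (4 * Q) < Metric.infDist x₀ C := by
  have hQ0 : 0 < Q := by linarith
  have hpos : 0 < Metric.infDist x₀ C := (hC.isClosed.notMem_iff_infDist_pos hC0).mp hxC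
  obtain ⟨ξ₀, hξ₀, hd⟩ := hC.exists_infDist_eq_dist hC0 x₀
  obtain ⟨x, ξ, hx0, hξ0, hxQ, hξC, hinj, hR⟩ :=
    exists_expansion (R := fun y y' => |y'| ≤ B * |y|) step hx₀ hξ₀ hpos
  set d := Metric.infDist x₀ C with hdd
  have hgrow : ∀ n, |x n - ξ n| ≤ B ^ n * d := by
    intro n
    induction n with
    | zero => rw [hx0, hξ0, hd, Real.dist_eq]; simp
    | succ n ih =>
      calc _ ≤ B * |x n - ξ n| := hR n
        _ ≤ B * (B ^ n * d) := by gcongr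
        _ = _ := by ring
  set M := ⌊(2 * Q * A) ^ Δ⌋₊ with hM
  -- Otherwise `ξ 0, …, ξ M` would be `M + 1` points of `C` with gaps at least `1/Q - 2/(4Q) =
  -- 1/(2Q)`, more than `hcard` allows.
  have hlt : 1 / (4 * Q) < B ^ M * d := by
    by_contra! hle
    have hsmall : ∀ n ∈ Finset.range (M + 1), |x n - ξ n| ≤ 1 / (4 * Q) := by
      intro n hn
      refine (hgrow n).trans (le_trans ?_ hle)
      have : n ≤ M := by simpa [Nat.lt_succ_iff] using hn
      gcongr
    have hsep : ∀ m ∈ Finset.range (M + 1), ∀ n ∈ Finset.range (M + 1), m ≠ n →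
        1 / (2 * Q) ≤ |ξ m - ξ n| := by
      intro m hm n hn hmn
      have h1 : 1 / Q ≤ |x m - x n| := by
        rw [div_le_iff₀ hQ0, mul_comm]
        exact one_le_mul_abs_sub hQ0 (hxQ m) (hxQ n) fun h => hmn (hinj h)
      have h2 := abs_le.mp (hsmall m hm)
      have h3 := abs_le.mp (hsmall n hn)
      have h4 : 1 / Q = 1 / (2 * Q) + 1 / (4 * Q) + 1 / (4 * Q) := by field_simp; norm_num
      rcases le_abs.mp h1 with h | h
      · exact le_abs.mpr (Or.inl (by linarith))
      · exact le_abs.mpr (Or.inr (by linarith))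
    have hr0 : 0 < 1 / (2 * Q) := by positivity
    have hinjξ : Set.InjOn ξ (Finset.range (M + 1)) := by
      intro m hm n hn h
      by_contra hne
      have := hsep m hm n hn hne
      rw [h, sub_self, abs_zero] at this
      linarith
    have h5 := hcard (1 / (2 * Q)) hr0 (by rw [div_le_one (by positivity)]; linarith)
      ((Finset.range (M + 1)).image ξ)
      (by
        intro y hy
        obtain ⟨n, -, rfl⟩ := Finset.mem_image.mp hy
        exact hξC n)
      (by
        intro y hy z hz hyz
        obtain ⟨m, hm, rfl⟩ := Finset.mem_image.mp hy
        obtain ⟨n, hn, rfl⟩ := Finset.mem_image.mp hz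
        exact hsep m hm n hn fun h => hyz (by rw [h]))
    rw [Finset.card_image_of_injOn hinjξ, Finset.card_range, div_div_eq_mul_div, div_one,
      mul_comm A, Nat.cast_add, Nat.cast_one] at h5
    exact absurd (Nat.lt_floor_add_one ((2 * Q * A) ^ Δ)) h5.not_gt
  have hBM : B ^ (-((2 * Q * A) ^ Δ)) ≤ (B ^ M)⁻¹ := by
    rw [← Real.rpow_natCast, ← Real.rpow_neg (by linarith)]
    exact Real.rpow_le_rpow_of_exponent_le hB (neg_le_neg (Nat.floor_le (by positivity)))
  calc B ^ (-((2 * Q * A) ^ Δ)) / (4 * Q) ≤ (B ^ M)⁻¹ * (1 / (4 * Q)) := by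
        rw [div_eq_mul_one_div]
        gcongr
    _ < (B ^ M)⁻¹ * (B ^ M * d) := by
        have : 0 < B ^ M := by positivity
        gcongr
    _ = d := by
        have : 0 < B ^ M := by positivity
        field_simp

/-! ### The bound for monic rational systems -/

theorem exp_lt_infDist_of_isMonicRationalIFS {J : ℕ} {f : Fin J → ℝ → ℝ} {C : Set ℝ} (hJ : 2 ≤ J)
    (hf : IsMonicRationalIFS f) (hO : OpenSetCondition f) (hA : IsAttractor f C) :
    ∃ ρ₀ : ℝ, ∀ ρ : ℝ, ρ₀ ≤ ρ → ∀ (p : ℤ) (q : ℕ), 0 < q → (p : ℝ) / (q : ℝ) ∉ C →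
      Real.exp (-ρ * (q : ℝ) ^ (dimH C).toReal) < Metric.infDist ((p : ℝ) / (q : ℝ)) C := by
  obtain ⟨hcontr, hform⟩ := hf
  choose e k r he hk hfe using hform
  obtain ⟨hC, hC0, hunion⟩ := hA
  have hmaps : ∀ j, ∀ c ∈ C, f j c ∈ C := fun j c hc => by
    rw [← hunion]
    exact Set.mem_iUnion.mpr ⟨j, c, hc, rfl⟩
  have hcov : ∀ c ∈ C, ∃ j, ∃ c' ∈ C, f j c' = c := fun c hc => by
    rw [← hunion] at hc
    exact Set.mem_iUnion.mp hc
  have hk0 : ∀ j, (0 : ℝ) < k j := fun j => by exact_mod_cast hk j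
  have he2 : ∀ j, (e j : ℝ) * e j = 1 := fun j => by
    rcases he j with h | h <;> simp [h]
  have hdist : ∀ j x y, |f j x - f j y| = 1 / (k j : ℝ) * |x - y| := by
    intro j x y
    have h1 : f j x - f j y = (e j : ℝ) * (1 / (k j : ℝ) * (x - y)) := by
      rw [hfe, hfe]
      ring
    have h2 : |(e j : ℝ)| = 1 := by
      rcases he j with h | h <;> simp [h]
    rw [h1, abs_mul, h2, one_mul, abs_mul, abs_of_pos (one_div_pos.mpr (hk0 j))]
  -- A monic map with denominator `1` is an isometry, not a contraction.
  have hk2 : ∀ j, 2 ≤ k j := by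
    intro j
    by_contra! hlt
    have h1 : k j = 1 := by have := hk j; omega
    obtain ⟨K, hK⟩ := hcontr j
    have h2 := hK.2.dist_le_mul 1 0
    rw [Real.dist_eq, hdist, h1, Real.dist_eq] at h2
    have h3 : (K : ℝ) < 1 := by exact_mod_cast hK.1
    norm_num at h2
    have h4 : (1 : ℝ) ≤ K := by exact_mod_cast h2
    linarith
  have hk2' : ∀ j, (2 : ℝ) ≤ k j := fun j => by exact_mod_cast hk2 j
  set B : ℝ := ∑ j, (k j : ℝ) with hBdef
  have hkB : ∀ j, (k j : ℝ) ≤ B := fun j =>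
    Finset.single_le_sum (f := fun j => (k j : ℝ)) (fun i _ => (hk0 i).le) (Finset.mem_univ j)
  have hB : 1 < B := by linarith [hk2' ⟨0, by omega⟩, hkB ⟨0, by omega⟩]
  have hlam : ∀ j, 1 / B ≤ 1 / (k j : ℝ) ∧ 1 / (k j : ℝ) ≤ 1 / 2 := fun j =>
    ⟨one_div_le_one_div_of_le (hk0 j) (hkB j), one_div_le_one_div_of_le two_pos (hk2' j)⟩
  obtain ⟨A, hA1, hcard⟩ := exists_card_separated_le hC hB hlam hdist hmaps hcov
  set Δ := (dimH C).toReal with hΔdef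
  -- The open set condition enters here: `C` has two distinct points, whereas `Δ = 0` would bound
  -- every separated set by one point.
  have hΔ : 0 < Δ := by
    obtain ⟨x, hx, y, hy, hxy⟩ := nontrivial_of_openSetCondition hJ
      (a := fun j => (e j : ℝ) / k j) (b := fun j => (r j : ℝ) / k j) hfe hO hC0 hmaps
    refine lt_of_le_of_ne ENNReal.toReal_nonneg fun h0 => ?_
    have hpos : 0 < |x - y| := abs_pos.mpr (sub_ne_zero.mpr hxy)
    have h1 := hcard (min 1 |x - y|) (by positivity) (min_le_left _ _) {x, y} (by simp [hx, hy])
      (by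
        intro u hu v hv huv
        simp only [Finset.mem_insert, Finset.mem_singleton] at hu hv
        rcases hu with rfl | rfl <;> rcases hv with rfl | rfl
        · exact absurd rfl huv
        · exact min_le_right _ _
        · rw [abs_sub_comm]; exact min_le_right _ _
        · exact absurd rfl huv)
    rw [Finset.card_pair hxy, ← h0, Real.rpow_zero] at h1
    norm_num at h1
  -- A common denominator of the `r j`: inverse branches then preserve `(1 / (q * R)) ℤ`.
  set R : ℕ := ∏ j, (r j).den with hRdef
  have hR0 : 0 < R := Finset.prod_pos fun j _ => (r j).pos
  have hR1 : (1 : ℝ) ≤ R := by exact_mod_cast hR0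
  have hRr : ∀ j, ∃ m : ℤ, (R : ℝ) * r j = m := by
    intro j
    obtain ⟨t, ht⟩ := Finset.dvd_prod_of_mem (fun j => (r j).den) (Finset.mem_univ j)
    refine ⟨t * (r j).num, ?_⟩
    have h1 : ((r j : ℚ) : ℝ) * (r j).den = (r j).num := by exact_mod_cast Rat.mul_den_eq_num (r j)
    rw [hRdef, ht]
    push_cast
    linear_combination (t : ℝ) * h1
  have hlogB : 0 < Real.log B := Real.log_pos hB
  -- The three terms absorb, in order, the power of `B`, the constant `4 * R`, and the factor `q`,
  -- through `log q ≤ q ^ Δ / Δ`.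
  refine ⟨(2 * R * A) ^ Δ * Real.log B + Real.log (4 * R) + 1 / Δ, fun ρ hρ p q hq hpq => ?_⟩
  have hq1 : (1 : ℝ) ≤ q := by exact_mod_cast hq
  have hq0 : (0 : ℝ) < q := by linarith
  have hQ : (1 : ℝ) ≤ q * R := by nlinarith
  have hmain := inv_pow_div_lt_infDist hC hC0 hQ hB.le hA1 hcard ?_
    (x₀ := (p : ℝ) / q) ⟨p * R, by push_cast; field_simp⟩ hpq
  · refine lt_of_le_of_lt ?_ hmain
    have hqΔ : 1 ≤ (q : ℝ) ^ Δ := Real.one_le_rpow hq1 hΔ.le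
    have hlogq : Real.log q ≤ (q : ℝ) ^ Δ / Δ := Real.log_le_rpow_div hq0.le hΔ
    have hlogR : 0 ≤ Real.log (4 * R) := Real.log_nonneg (by linarith)
    have hsplit : (2 * (q * R) * A) ^ Δ = (2 * R * A) ^ Δ * (q : ℝ) ^ Δ := by
      rw [← Real.mul_rpow (by positivity) hq0.le]
      ring_nf
    have h4 : 4 * ((q : ℝ) * R) = Real.exp (Real.log (4 * R) + Real.log q) := by
      rw [Real.exp_add, Real.exp_log (by positivity), Real.exp_log hq0]
      ring
    rw [hsplit, h4, Real.rpow_def_of_pos (show 0 < B by linarith), ← Real.exp_sub, Real.exp_le_exp]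
    have h5 := mul_le_mul_of_nonneg_right hρ (by linarith : 0 ≤ (q : ℝ) ^ Δ)
    have h6 := mul_le_mul_of_nonneg_left hqΔ hlogR
    have h7 : 1 / Δ * (q : ℝ) ^ Δ = (q : ℝ) ^ Δ / Δ := by ring
    rw [add_mul, add_mul, h7] at h5
    linarith
  · rintro x ⟨m, hm⟩ ξ hξ
    obtain ⟨j, ξ', hξ', rfl⟩ := hcov ξ hξ
    obtain ⟨t, ht⟩ := hRr j
    have hx : f j (e j * (k j * x - r j)) = x := by
      rw [hfe]
      have := (hk0 j).ne'
      field_simp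
      linear_combination (k j * x - r j : ℝ) * he2 j
    refine ⟨e j * (k j * x - r j), ⟨e j * (k j * m - q * t), ?_⟩, ξ', hξ', ?_, ?_⟩
    · push_cast
      linear_combination (e j * k j : ℝ) * hm - (e j * q : ℝ) * ht
    · conv_lhs => rw [← hx]
      refine two_mul_infDist_le hC hC0 (hmaps j) (fun y z => ?_) _
      rw [hdist]
      exact mul_le_mul_of_nonneg_right (hlam j).2 (abs_nonneg _)
    · conv_rhs => rw [← hx]
      rw [hdist, ← mul_assoc]
      refine le_mul_of_one_le_left (abs_nonneg _) ?_
      rw [mul_one_div, one_le_div (hk0 j)]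
      exact hkB j

/-! ### Missing digit sets and their dimension -/

theorem missingDigitSet_subset_Icc {b : ℕ} (W : Finset (Fin b)) :
    missingDigitSet b W ⊆ Set.Icc 0 1 := by
  rintro _ ⟨w, -, rfl⟩
  exact ⟨Real.ofDigits_nonneg w, Real.ofDigits_le_one w⟩

theorem abs_sub_le_one_of_mem_missingDigitSet {b : ℕ} {W : Finset (Fin b)} {x y : ℝ}
    (hx : x ∈ missingDigitSet b W) (hy : y ∈ missingDigitSet b W) : |x - y| ≤ 1 := by
  have h1 := missingDigitSet_subset_Icc W hx
  have h2 := missingDigitSet_subset_Icc W hy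
  exact abs_le.mpr ⟨by linarith [h1.1, h2.2], by linarith [h1.2, h2.1]⟩

theorem isCompact_missingDigitSet {b : ℕ} (W : Finset (Fin b)) :
    IsCompact (missingDigitSet b W) := by
  refine IsCompact.image (IsClosed.isCompact ?_) Real.continuous_ofDigits
  rw [Set.ofPred_forall]
  refine isClosed_iInter fun i => ?_
  exact (isClosed_discrete (W : Set (Fin b))).preimage (continuous_apply i)

theorem missingDigitSet_nonempty {b : ℕ} {W : Finset (Fin b)} (hW : W.Nonempty) :
    (missingDigitSet b W).Nonempty := by
  obtain ⟨w, hw⟩ := hW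
  exact ⟨_, fun _ => w, fun _ => hw, rfl⟩

theorem ofDigits_eq_head_add_tail_div {b : ℕ} (w : ℕ → Fin b) :
    Real.ofDigits w = ((w 0 : ℕ) + Real.ofDigits fun i => w (i + 1)) / (b : ℝ) := by
  rw [Real.ofDigits_eq_sum_add_ofDigits w 1]
  simp [Real.ofDigitsTerm]
  ring

theorem digit_add_div_mem_missingDigitSet {b : ℕ} {W : Finset (Fin b)} {w : Fin b} (hw : w ∈ W)
    {c : ℝ} (hc : c ∈ missingDigitSet b W) :
    ((w : ℕ) + c) / (b : ℝ) ∈ missingDigitSet b W := by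
  obtain ⟨v, hv, rfl⟩ := hc
  refine ⟨fun i => Nat.casesOn i w v, ?_, ?_⟩
  · rintro (_ | i)
    · exact hw
    · exact hv i
  · rw [ofDigits_eq_head_add_tail_div]
    rfl

theorem exists_digit_add_div_eq {b : ℕ} {W : Finset (Fin b)} {c : ℝ}
    (hc : c ∈ missingDigitSet b W) :
    ∃ w ∈ W, ∃ c' ∈ missingDigitSet b W, ((w : ℕ) + c') / (b : ℝ) = c := by
  obtain ⟨v, hv, rfl⟩ := hc
  exact ⟨v 0, hv 0, _, ⟨fun i => v (i + 1), fun i => hv _, rfl⟩,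
    (ofDigits_eq_head_add_tail_div v).symm⟩

/-- The `|W| ^ k` level `k` pieces of the missing digit set, indexed by natural numbers. -/
theorem exists_level_pieces {b : ℕ} (hb : 0 < b) (W : Finset (Fin b)) (k : ℕ) :
    ∃ D : Finset ℕ, D.card = W.card ^ k ∧
      (∀ m ∈ D, ∀ c ∈ missingDigitSet b W, ((m : ℝ) + c) / (b : ℝ) ^ k ∈ missingDigitSet b W) ∧
      ∀ c ∈ missingDigitSet b W, ∃ m ∈ D, ∃ c' ∈ missingDigitSet b W,
        ((m : ℝ) + c') / (b : ℝ) ^ k = c := by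
  have hb0 : (b : ℝ) ≠ 0 := by exact_mod_cast hb.ne'
  induction k with
  | zero => exact ⟨{0}, by simp, by simp, fun c hc => ⟨0, by simp, c, hc, by simp⟩⟩
  | succ k ih =>
    obtain ⟨D, h1, h2, h3⟩ := ih
    have hstep : ∀ (m w : ℕ) (c : ℝ), (((b * m + w : ℕ) : ℝ) + c) / (b : ℝ) ^ (k + 1) =
        ((m : ℝ) + ((w : ℝ) + c) / b) / (b : ℝ) ^ k := by
      intro m w c
      push_cast
      rw [pow_succ]
      field_simp
      ring
    refine ⟨(D ×ˢ W).image fun z => b * z.1 + (z.2 : ℕ), ?_, ?_, ?_⟩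
    · rw [Finset.card_image_of_injective, Finset.card_product, h1, pow_succ]
      rintro ⟨m, w⟩ ⟨n, v⟩ h
      simp only at h
      have e1 := congrArg (· / b) h
      have e2 := congrArg (· % b) h
      simp only [Nat.mul_add_div hb, Nat.div_eq_of_lt w.2, Nat.div_eq_of_lt v.2, add_zero] at e1
      simp only [Nat.mul_add_mod, Nat.mod_eq_of_lt w.2, Nat.mod_eq_of_lt v.2] at e2
      rw [e1, Fin.ext e2]
    · intro x hx c hc
      obtain ⟨⟨m, w⟩, hz, rfl⟩ := Finset.mem_image.mp hx
      rw [Finset.mem_product] at hz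
      rw [hstep]
      exact h2 m hz.1 _ (digit_add_div_mem_missingDigitSet hz.2 hc)
    · intro c hc
      obtain ⟨m, hm, c', hc', rfl⟩ := h3 c hc
      obtain ⟨w, hw, c'', hc'', rfl⟩ := exists_digit_add_div_eq hc'
      exact ⟨b * m + w, Finset.mem_image.mpr ⟨(m, w), Finset.mem_product.mpr ⟨hm, hw⟩, rfl⟩, c'',
        hc'', hstep m w c''⟩

theorem rpow_log_div_log {b w : ℝ} (hb : 1 < b) (hw : 0 < w) :
    b ^ (Real.log w / Real.log b) = w := by
  rw [Real.rpow_def_of_pos (by linarith), mul_div_cancel₀ _ (Real.log_pos hb).ne',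
    Real.exp_log hw]

theorem log_div_log_le_dimH_missingDigitSet {b : ℕ} (hb : 2 ≤ b) {W : Finset (Fin b)}
    (hW : W.Nonempty) :
    Real.log W.card / Real.log b ≤ (dimH (missingDigitSet b W)).toReal := by
  have hb1 : (2 : ℝ) ≤ b := by exact_mod_cast hb
  have hb0 : (0 : ℝ) < b := by linarith
  obtain ⟨A, hA1, hA⟩ := exists_card_separated_le (ι := W)
    (f := fun w y => (((w : Fin b) : ℕ) + y) / (b : ℝ)) (lam := fun _ => 1 / (b : ℝ)) (B := b)
    (isCompact_missingDigitSet W) (by linarith)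
    (fun _ => ⟨le_rfl, one_div_le_one_div_of_le two_pos hb1⟩)
    (fun w x y => by
      rw [← sub_div, abs_div, abs_of_pos hb0]
      ring_nf)
    (fun w c hc => digit_add_div_mem_missingDigitSet w.2 hc)
    (fun c hc => by
      obtain ⟨w, hw, h⟩ := exists_digit_add_div_eq hc
      exact ⟨⟨w, hw⟩, h⟩)
  set s := (dimH (missingDigitSet b W)).toReal with hs
  obtain ⟨c, hc⟩ := missingDigitSet_nonempty hW
  have hlogb : 0 < Real.log b := Real.log_pos (by linarith)
  have hcard0 : (0 : ℝ) < W.card := by exact_mod_cast hW.card_pos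
  -- Logarithm of `|W| ^ k ≤ (A * b ^ k) ^ s`, got from one point in each level `k` piece. As `k` is
  -- arbitrary, its coefficient cannot be positive.
  have hk : ∀ k : ℕ, k * (Real.log W.card - s * Real.log b) ≤ s * Real.log A := by
    intro k
    obtain ⟨D, h1, h2, -⟩ := exists_level_pieces (by omega) W k
    have hbk : (0 : ℝ) < (b : ℝ) ^ k := by positivity
    have hsep : ∀ m n : ℕ, m ≠ n →
        1 / (b : ℝ) ^ k ≤ |((m : ℝ) + c) / (b : ℝ) ^ k - ((n : ℝ) + c) / (b : ℝ) ^ k| := by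
      intro m n hmn
      rw [← sub_div, abs_div, abs_of_pos hbk, add_sub_add_right_eq_sub]
      gcongr
      have : (1 : ℤ) ≤ |(m : ℤ) - n| := Int.one_le_abs (by omega)
      exact_mod_cast this
    have hle := hA (1 / (b : ℝ) ^ k) (by positivity)
      (by rw [div_le_one hbk]; exact one_le_pow₀ (by linarith))
      (D.image fun m : ℕ => ((m : ℝ) + c) / (b : ℝ) ^ k)
      (by
        intro x hx
        obtain ⟨m, hm, rfl⟩ := Finset.mem_image.mp hx
        exact h2 m hm c hc)
      (by
        intro x hx y hy hxy
        obtain ⟨m, hm, rfl⟩ := Finset.mem_image.mp hx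
        obtain ⟨n, hn, rfl⟩ := Finset.mem_image.mp hy
        exact hsep m n fun h => hxy (by rw [h]))
    rw [Finset.card_image_of_injective, h1, div_div_eq_mul_div, div_one] at hle
    · have hlog := Real.log_le_log (by rw [Nat.cast_pow]; positivity) hle
      rw [Nat.cast_pow, Real.log_pow, Real.log_rpow (by positivity),
        Real.log_mul (by positivity) (by positivity), Real.log_pow] at hlog
      linarith
    · intro m n h
      by_contra hne
      have h3 := hsep m n hne
      simp only at h
      rw [h, sub_self, abs_zero] at h3
      have : 0 < 1 / (b : ℝ) ^ k := by positivity
      linarith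
  rw [div_le_iff₀ hlogb]
  by_contra! hlt
  obtain ⟨k, hk'⟩ := exists_nat_gt (s * Real.log A / (Real.log W.card - s * Real.log b))
  rw [div_lt_iff₀ (by linarith)] at hk'
  exact absurd (hk k) hk'.not_ge

theorem dimH_missingDigitSet_le {b : ℕ} (hb : 2 ≤ b) {W : Finset (Fin b)} (hW : W.Nonempty) :
    dimH (missingDigitSet b W) ≤ ENNReal.ofReal (Real.log W.card / Real.log b) := by
  have hb1 : (1 : ℝ) < b := by exact_mod_cast hb
  have hb0 : (0 : ℝ) < b := by linarith
  have hcard0 : (0 : ℝ) < W.card := by exact_mod_cast hW.card_pos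
  have hcard1 : (1 : ℝ) ≤ W.card := by exact_mod_cast hW.card_pos
  set s := Real.log W.card / Real.log b with hs
  have hs0 : 0 ≤ s := div_nonneg (Real.log_nonneg hcard1) (Real.log_nonneg hb1.le)
  have hbs : (b : ℝ) ^ s = W.card := rpow_log_div_log hb1 hcard0
  choose D h1 h2 h3 using exists_level_pieces (show 0 < b by omega) W
  have hdiam : ∀ (n : ℕ) (m : D n),
      Metric.ediam ((fun y : ℝ => (((m : ℕ) : ℝ) + y) / (b : ℝ) ^ n) '' missingDigitSet b W) ≤
        ENNReal.ofReal ((b : ℝ)⁻¹ ^ n) := by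
    intro n m
    refine Metric.ediam_le ?_
    rintro _ ⟨x, hx, rfl⟩ _ ⟨y, hy, rfl⟩
    rw [edist_dist, Real.dist_eq]
    refine ENNReal.ofReal_le_ofReal ?_
    rw [← sub_div, add_sub_add_left_eq_sub, abs_div, abs_of_pos (by positivity : 0 < (b : ℝ) ^ n),
      div_le_iff₀ (by positivity), ← mul_pow, inv_mul_cancel₀ hb0.ne', one_pow]
    exact abs_sub_le_one_of_mem_missingDigitSet hx hy
  -- The `|W| ^ n` pieces of diameter at most `b ^ (-n)` have `s`-sum at most `|W| ^ n * b ^ (-n *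
  -- s) = 1`.
  have hmeas : MeasureTheory.Measure.hausdorffMeasure s (missingDigitSet b W) ≤ 1 := by
    refine (MeasureTheory.Measure.hausdorffMeasure_le_liminf_sum s (missingDigitSet b W)
      (l := Filter.atTop) (ι := fun n => D n) (fun n => ENNReal.ofReal ((b : ℝ)⁻¹ ^ n)) ?_
      (fun n m => (fun y : ℝ => (((m : ℕ) : ℝ) + y) / (b : ℝ) ^ n) '' missingDigitSet b W)
      (Filter.Eventually.of_forall hdiam) (Filter.Eventually.of_forall fun n c hc => ?_)).trans ?_
    · rw [← ENNReal.ofReal_zero]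
      exact ENNReal.tendsto_ofReal
        (tendsto_pow_atTop_nhds_zero_of_lt_one (by positivity) (inv_lt_one_of_one_lt₀ hb1))
    · obtain ⟨m, hm, c', hc', h⟩ := h3 n c hc
      exact Set.mem_iUnion.mpr ⟨⟨m, hm⟩, c', hc', h⟩
    · refine (Filter.liminf_le_liminf (v := fun _ => (1 : ENNReal))
        (Filter.Eventually.of_forall fun n => ?_)).trans (Filter.liminf_const _).le
      calc _ ≤ ∑ _m : D n, ENNReal.ofReal ((b : ℝ)⁻¹ ^ n) ^ s :=
            Finset.sum_le_sum fun m _ => ENNReal.rpow_le_rpow (hdiam n m) hs0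
        _ = ENNReal.ofReal ((W.card : ℝ) ^ n) * ENNReal.ofReal (((b : ℝ)⁻¹ ^ n) ^ s) := by
            rw [Finset.sum_const, Finset.card_univ, Fintype.card_coe, h1, nsmul_eq_mul,
              ENNReal.ofReal_rpow_of_nonneg (by positivity) hs0, ← Nat.cast_pow,
              ENNReal.ofReal_natCast]
        _ = 1 := by
            rw [← ENNReal.ofReal_mul (by positivity), ← ENNReal.ofReal_one]
            congr 1
            rw [← Real.rpow_natCast (b : ℝ)⁻¹, ← Real.rpow_mul (by positivity), mul_comm (n : ℝ),
              Real.rpow_mul (by positivity), Real.inv_rpow hb0.le, hbs, Real.rpow_natCast, ← mul_pow,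
              mul_inv_cancel₀ hcard0.ne', one_pow]
  have h4 := dimH_le_of_hausdorffMeasure_ne_top (d := s.toNNReal) (s := missingDigitSet b W)
    (by
      rw [Real.coe_toNNReal _ hs0]
      exact ne_top_of_le_ne_top ENNReal.one_ne_top hmeas)
  exact h4

theorem dimH_missingDigitSet {b : ℕ} (hb : 2 ≤ b) {W : Finset (Fin b)} (hW : W.Nonempty) :
    dimH (missingDigitSet b W) = ENNReal.ofReal (Real.log W.card / Real.log b) := by
  refine le_antisymm (dimH_missingDigitSet_le hb hW) ?_
  rw [ENNReal.ofReal_le_iff_le_toReal (dimH_real_ne_top _)]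
  exact log_div_log_le_dimH_missingDigitSet hb hW

/-! ### Explicit bounds for missing digit sets -/

theorem rpow_div_lt_infDist_missingDigitSet {b : ℕ} (hb : 2 ≤ b) {W : Finset (Fin b)}
    (hW : W.Nonempty) {Δ : ℝ} (hΔ : Δ = Real.log W.card / Real.log b) (hΔ0 : 0 < Δ) {p : ℤ} {q : ℕ}
    (hq : 0 < q) (hpq : (p : ℝ) / q ∉ missingDigitSet b W) :
    (b : ℝ) ^ (-((2 * (b : ℝ)) ^ Δ * (q : ℝ) ^ Δ)) / (2 * (q : ℝ)) <
      Metric.infDist ((p : ℝ) / q) (missingDigitSet b W) := by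
  have hb2 : (2 : ℝ) ≤ b := by exact_mod_cast hb
  have hb1 : (1 : ℝ) < b := by linarith
  have hb0 : (0 : ℝ) < b := by linarith
  have hcard0 : (0 : ℝ) < W.card := by exact_mod_cast hW.card_pos
  have hq0 : (0 : ℝ) < q := by exact_mod_cast hq
  have hC := isCompact_missingDigitSet W
  have hC0 := missingDigitSet_nonempty hW
  have hpos := (hC.isClosed.notMem_iff_infDist_pos hC0).mp hpq
  obtain ⟨ξ₀, hξ₀, hd⟩ := hC.exists_infDist_eq_dist hC0 ((p : ℝ) / q)
  rw [Real.dist_eq] at hd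
  obtain ⟨x, ξ, hx0, hξ0, hxQ, hξC, hinj, hR⟩ :=
    -- All inverse branches have slope `b`, so the difference is known exactly, not only up to an
    -- inequality.
    exists_expansion (C := missingDigitSet b W) (Q := q) (R := fun y y' => y' = b * y)
      (by
        rintro x ⟨m, hm⟩ ξ hξ
        obtain ⟨w, hw, ξ', hξ', rfl⟩ := exists_digit_add_div_eq hξ
        refine ⟨b * x - (w : ℕ), ⟨b * m - q * (w : ℕ), ?_⟩, ξ', hξ', ?_, ?_⟩
        · push_cast
          linear_combination (b : ℝ) * hm
        · have h := two_mul_infDist_le hC hC0 (g := fun y => ((w : ℕ) + y) / (b : ℝ))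
            (fun c hc => digit_add_div_mem_missingDigitSet hw hc)
            (fun y z => by
              rw [← sub_div, add_sub_add_left_eq_sub, abs_div, abs_of_pos hb0,
                div_le_iff₀ hb0]
              nlinarith [abs_nonneg (y - z)]) (b * x - (w : ℕ))
          rwa [show ((w : ℕ) + (b * x - (w : ℕ))) / (b : ℝ) = x by field_simp; ring] at h
        · field_simp
          ring)
      (⟨p, by field_simp⟩ : ∃ k : ℤ, (q : ℝ) * ((p : ℝ) / q) = k) hξ₀ hpos
  have hgrow : ∀ n, x n - ξ n = (b : ℝ) ^ n * ((p : ℝ) / q - ξ₀) := by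
    intro n
    induction n with
    | zero => rw [hx0, hξ0]; simp
    | succ n ih => rw [hR n, ih]; ring
  set d := Metric.infDist ((p : ℝ) / q) (missingDigitSet b W) with hdd
  have hex : ∃ k : ℕ, 2 * q ≤ b ^ k := ⟨2 * q, (Nat.lt_pow_self (by omega)).le⟩
  classical
  -- The first inequality makes level `k + 1` pieces no longer than `1 / (2 * q)`; the second keeps
  -- their number below `(2 * b * q) ^ Δ`.
  obtain ⟨k, hk1, hk2⟩ : ∃ k : ℕ, 2 * q ≤ b ^ (k + 1) ∧ b ^ k < 2 * q := by
    have hne : Nat.find hex ≠ 0 := by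
      intro h0
      have := Nat.find_spec hex
      rw [h0, pow_zero] at this
      omega
    obtain ⟨k, hk⟩ := Nat.exists_eq_succ_of_ne_zero hne
    refine ⟨k, by have := Nat.find_spec hex; rwa [hk] at this, ?_⟩
    exact not_le.mp (Nat.find_min hex (by omega))
  have hk1' : 2 * (q : ℝ) ≤ (b : ℝ) ^ (k + 1) := by exact_mod_cast hk1
  have hk2' : (b : ℝ) ^ k < 2 * (q : ℝ) := by exact_mod_cast hk2
  obtain ⟨D, hD1, -, hD3⟩ := exists_level_pieces (by omega) W (k + 1)
  set M := W.card ^ (k + 1) with hM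
  have hMlt : (M : ℝ) < (2 * (b : ℝ)) ^ Δ * (q : ℝ) ^ Δ := by
    calc (M : ℝ) = ((b : ℝ) ^ (k + 1)) ^ Δ := by
          rw [← Real.rpow_natCast, ← Real.rpow_mul hb0.le, mul_comm, Real.rpow_mul hb0.le, hΔ,
            rpow_log_div_log hb1 hcard0, Real.rpow_natCast, hM, Nat.cast_pow]
      _ < (2 * b * q) ^ Δ := by
          apply Real.rpow_lt_rpow (by positivity) _ hΔ0
          rw [pow_succ]
          nlinarith
      _ = _ := Real.mul_rpow (by positivity) (by positivity)
  -- Otherwise two of `ξ 0, …, ξ M` share one of the `M` pieces, and the corresponding distinct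
  -- points of `(1/q)ℤ` are less than `1/q` apart.
  have hlt : 1 / (2 * (q : ℝ)) < (b : ℝ) ^ M * d := by
    by_contra! hle
    choose m hm c hc hmc using fun n => hD3 (ξ n) (hξC n)
    obtain ⟨i, hi, j, hj, hij, hmij⟩ := Finset.exists_ne_map_eq_of_card_lt_of_maps_to
      (s := Finset.range (M + 1)) (t := D) (by rw [hD1, Finset.card_range]; omega)
      (f := m) (fun n _ => hm n)
    have aux : ∀ i j, i < j → j ≤ M → m i = m j → False := by
      intro i j hij hj hmij
      have h1 : |ξ i - ξ j| ≤ 1 / (2 * q) := by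
        rw [← hmc i, ← hmc j, hmij, ← sub_div, add_sub_add_left_eq_sub, abs_div,
          abs_of_pos (by positivity : 0 < (b : ℝ) ^ (k + 1))]
        exact div_le_div₀ zero_le_one (abs_sub_le_one_of_mem_missingDigitSet (hc i) (hc j))
          (by positivity) hk1'
      have h2 : |((b : ℝ) ^ i - (b : ℝ) ^ j) * ((p : ℝ) / q - ξ₀)| < 1 / (2 * q) := by
        have hbij : (b : ℝ) ^ i < (b : ℝ) ^ j := pow_lt_pow_right₀ hb1 hij
        have hbi : 0 < (b : ℝ) ^ i := by positivity
        rw [abs_mul, ← hd, abs_of_neg (by linarith)]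
        refine lt_of_lt_of_le ?_ hle
        have hjM : (b : ℝ) ^ j ≤ (b : ℝ) ^ M := pow_le_pow_right₀ hb1.le hj
        gcongr
        linarith
      have h3 : x i - x j = (ξ i - ξ j) + ((b : ℝ) ^ i - (b : ℝ) ^ j) * ((p : ℝ) / q - ξ₀) := by
        linear_combination hgrow i - hgrow j
      have h4 : |x i - x j| < 1 / q := by
        rw [h3]
        calc _ ≤ _ := abs_add_le _ _
          _ < 1 / (2 * q) + 1 / (2 * (q : ℝ)) := add_lt_add_of_le_of_lt h1 h2
          _ = 1 / q := by field_simp; norm_num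
      have h5 := one_le_mul_abs_sub hq0 (hxQ i) (hxQ j) fun h => hij.ne (hinj h)
      rw [lt_div_iff₀ hq0, mul_comm] at h4
      linarith
    rw [Finset.mem_range, Nat.lt_succ_iff] at hi hj
    rcases lt_or_gt_of_ne hij with h | h
    · exact aux i j h hj hmij
    · exact aux j i h hi hmij.symm
  have hbM : (b : ℝ) ^ (-((2 * (b : ℝ)) ^ Δ * (q : ℝ) ^ Δ)) ≤ ((b : ℝ) ^ M)⁻¹ := by
    rw [← Real.rpow_natCast, ← Real.rpow_neg hb0.le]
    exact Real.rpow_le_rpow_of_exponent_le hb1.le (neg_le_neg hMlt.le)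
  have hbM0 : 0 < (b : ℝ) ^ M := by positivity
  calc _ ≤ ((b : ℝ) ^ M)⁻¹ * (1 / (2 * q)) := by
        rw [div_eq_mul_one_div]
        gcongr
    _ < ((b : ℝ) ^ M)⁻¹ * ((b : ℝ) ^ M * d) := by gcongr
    _ = d := by field_simp

/-- Holds because `log q = o(q ^ Δ)`; it lets the excess `δ - (2 * b) ^ Δ` absorb the denominator `2
* q`. -/
theorem eventually_two_mul_lt_rpow {b a Δ : ℝ} (hb : 1 < b) (ha : 0 < a) (hΔ : 0 < Δ) :
    ∃ N : ℕ, ∀ q : ℕ, N ≤ q → 2 * (q : ℝ) < b ^ (a * (q : ℝ) ^ Δ) := by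
  have hε : 0 < a * Real.log b / 3 := by
    have := Real.log_pos hb
    positivity
  have hlog := (isLittleO_log_rpow_atTop hΔ).bound hε
  obtain ⟨N, hN⟩ := Filter.eventually_atTop.mp
    ((tendsto_natCast_atTop_atTop (R := ℝ)).eventually hlog)
  refine ⟨max N 2, fun q hq => ?_⟩
  have h1 := hN q (le_trans (le_max_left _ _) hq)
  have hq2 : (2 : ℝ) ≤ q := by exact_mod_cast le_trans (le_max_right _ _) hq
  have hq0 : (0 : ℝ) < q := by linarith
  have hqΔ : 0 < (q : ℝ) ^ Δ := by positivity
  rw [Real.norm_eq_abs, Real.norm_eq_abs, abs_of_pos hqΔ] at h1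
  have h2 := (le_abs_self _).trans h1
  have h3 : Real.log 2 ≤ Real.log q := Real.log_le_log two_pos hq2
  rw [Real.rpow_def_of_pos (by linarith), ← Real.log_lt_iff_lt_exp (by positivity),
    Real.log_mul two_ne_zero hq0.ne']
  nlinarith [mul_pos hε hqΔ]

theorem finite_good_approximations_missingDigitSet {b : ℕ} (hb : 2 ≤ b) {W : Finset (Fin b)}
    (hW : W.Nonempty) {Δ : ℝ} (hΔ : Δ = Real.log W.card / Real.log b) (hΔ0 : 0 < Δ) {ξ : ℝ}
    (hξ : ξ ∈ missingDigitSet b W) {δ : ℝ} (hδ : (2 * (b : ℝ)) ^ Δ < δ) :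
    {x : ℤ × ℕ | 0 < x.2 ∧ (x.1 : ℝ) / (x.2 : ℝ) ∉ missingDigitSet b W ∧
      |ξ - (x.1 : ℝ) / (x.2 : ℝ)| ≤ (b : ℝ) ^ (-(δ * (x.2 : ℝ) ^ Δ))}.Finite := by
  have hb1 : (1 : ℝ) < b := by exact_mod_cast hb
  have hb0 : (0 : ℝ) < b := by linarith
  obtain ⟨N, hN⟩ := eventually_two_mul_lt_rpow hb1 (sub_pos.mpr hδ) hΔ0
  -- For each `q < N`, `p / q` lies within `1` of `ξ ∈ [0, 1]`, so `|p| ≤ 2 * q`.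
  refine ((Set.finite_Icc (-(2 * N : ℤ)) (2 * N)).prod (Set.finite_Iio N)).subset ?_
  rintro ⟨p, q⟩ ⟨hq, hpq, hle⟩
  simp only at hq hpq hle
  have hq0 : (0 : ℝ) < q := by exact_mod_cast hq
  have hqN : q < N := by
    by_contra! hNq
    have h1 := rpow_div_lt_infDist_missingDigitSet hb hW hΔ hΔ0 hq hpq
    have h2 : Metric.infDist ((p : ℝ) / q) (missingDigitSet b W) ≤ |ξ - (p : ℝ) / q| := by
      rw [abs_sub_comm]
      exact Metric.infDist_le_dist_of_mem hξ
    have h3 := h1.trans_le (h2.trans hle)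
    rw [div_lt_iff₀ (by positivity)] at h3
    have h4 := hN q hNq
    have h5 : (b : ℝ) ^ (-((2 * (b : ℝ)) ^ Δ * (q : ℝ) ^ Δ)) =
        (b : ℝ) ^ (-(δ * (q : ℝ) ^ Δ)) * (b : ℝ) ^ ((δ - (2 * (b : ℝ)) ^ Δ) * (q : ℝ) ^ Δ) := by
      rw [← Real.rpow_add hb0]
      ring_nf
    rw [h5] at h3
    have h6 := lt_of_mul_lt_mul_left h3 (by positivity)
    linarith
  refine ⟨?_, hqN⟩
  have hδ0 : 0 < δ := lt_trans (by positivity) hδ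
  have h1 : (b : ℝ) ^ (-(δ * (q : ℝ) ^ Δ)) ≤ 1 :=
    Real.rpow_le_one_of_one_le_of_nonpos hb1.le (neg_nonpos.mpr (by positivity))
  have h2 := abs_le.mp (hle.trans h1)
  have h3 := missingDigitSet_subset_Icc W hξ
  have h4 : (p : ℝ) / q ≤ 2 := by linarith [h3.2]
  have h5 : -2 ≤ (p : ℝ) / q := by linarith [h3.1]
  rw [div_le_iff₀ hq0] at h4
  rw [le_div_iff₀ hq0] at h5
  have h4' : p ≤ 2 * (q : ℤ) := by exact_mod_cast h4
  have h5' : -2 * (q : ℤ) ≤ p := by exact_mod_cast h5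
  exact ⟨by simp only; omega, by simp only; omega⟩

theorem theorem3p6 :
    (∀ (J : ℕ) (f : Fin J → ℝ → ℝ) (C : Set ℝ),
      2 ≤ J → IsMonicRationalIFS f → OpenSetCondition f → IsAttractor f C →
      ∃ ρ₀ : ℝ, ∀ ρ : ℝ, ρ₀ ≤ ρ → ∀ (p : ℤ) (q : ℕ), 0 < q → (p : ℝ) / (q : ℝ) ∉ C →
        Real.exp (-ρ * (q : ℝ) ^ (dimH C).toReal) < Metric.infDist ((p : ℝ) / (q : ℝ)) C) ∧
    (∀ (b : ℕ) (W : Finset (Fin b)) (Δ : ℝ),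
      3 ≤ b → 2 ≤ W.card → W.card ≤ b - 1 → Δ = Real.log (W.card : ℝ) / Real.log (b : ℝ) →
      dimH (missingDigitSet b W) = ENNReal.ofReal Δ ∧
      (∀ (p : ℤ) (q : ℕ), 0 < q → (p : ℝ) / (q : ℝ) ∉ missingDigitSet b W →
        (b : ℝ) ^ (-((2 * (b : ℝ)) ^ Δ * (q : ℝ) ^ Δ)) / (2 * (q : ℝ)) <
          Metric.infDist ((p : ℝ) / (q : ℝ)) (missingDigitSet b W)) ∧
      (∀ ξ ∈ missingDigitSet b W, ∀ δ : ℝ, (2 * (b : ℝ)) ^ Δ < δ →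
        {x : ℤ × ℕ | 0 < x.2 ∧ (x.1 : ℝ) / (x.2 : ℝ) ∉ missingDigitSet b W ∧
          |ξ - (x.1 : ℝ) / (x.2 : ℝ)| ≤ (b : ℝ) ^ (-(δ * (x.2 : ℝ) ^ Δ))}.Finite)) := by
  refine ⟨fun J f C hJ hf hO hA => exp_lt_infDist_of_isMonicRationalIFS hJ hf hO hA, ?_⟩
  intro b W Δ hb hW _ hΔ
  have hW0 : W.Nonempty := Finset.card_pos.mp (by omega)
  have hΔ0 : 0 < Δ := by
    rw [hΔ]
    exact div_pos (Real.log_pos (by exact_mod_cast hW))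
      (Real.log_pos (by exact_mod_cast (show 1 < b by omega)))
  refine ⟨hΔ ▸ dimH_missingDigitSet (by omega) hW0, fun p q hq hpq => ?_, fun ξ hξ δ hδ => ?_⟩
  · exact rpow_div_lt_infDist_missingDigitSet (by omega) hW0 hΔ hΔ0 hq hpq
  · exact finite_good_approximations_missingDigitSet (by omega) hW0 hΔ hΔ0 hξ hδ
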